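/- **Definitions.** A real univariate polynomial $Q=\sum_{j=0}^d a_jx^j$, $a_d\neq 0$, is *hyperbolic* if all its roots are real; its *sign pattern* is $(\operatorname{sgn}a_d,\operatorname{sgn}a_{d-1},\ldots,\operatorname{sgn}a_0)$. For positive integers $m,n,q$ with $m+n+q=d+1$, $\Sigma_{m,n,q}$ denotes the sign pattern consisting of $m$ signs $+$, followed by $n$ signs $-$, followed by $q$ signs $+$. For integers $u,v,w\geq 0$ with $u+v+w=d-2$, the couple $(\Sigma_{m,n,q},(u,v,w))$ is *realizable* if there is a hyperbolic polynomial of degree $d$ with sign pattern $\Sigma_{m,n,q}$ whose $d$ roots have pairwise distinct moduli and which has exactly two positive roots $\beta<\alpha$, such that exactly $u$ of the moduli of the negative roots are smaller than $\beta$, exactly $v$ lie between $\beta$ and $\alpha$, and exactly $w$ are larger than $\alpha$; such a polynomial is said to *realize* the couple. Let $i_r$ be the map $Q(x)\mapsto x^dQ(1/x)/Q(0)$ on polynomials $Q$ of degree $d$ with $Q(0)\neq 0$. **Theorem 1.** Let $n=q=2$ and $d=m+3$. (1) Suppose that $d\geq 7$. If the couple $(\Sigma_{m,2,2},(u,v,w))$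 is realizable, then $w\geq m-3$. For each fixed $d\geq 7$, there are exactly $15$ triples $(u,v,w)$ of nonnegative integers with $u+v+w=d-2$ and $w\geq m-3$. (2) For $d\geq 6$, there are exactly $10$ triples $(u,v,w)$ of nonnegative integers with $u+v+w=d-2$ and $u+v\leq 3$, and all of them, as well as the triple $(0,4,m-3)$, are realizable with the sign pattern $\Sigma_{m,2,2}$. (3) For $d\geq 6$, the triples $(4,0,m-3)$, $(3,1,m-3)$, $(2,2,m-3)$ and $(1,3,m-3)$ are not realizable with the sign pattern $\Sigma_{m,2,2}$. Moreover, for $d\geq 6$, if $Q$ realizes $(\Sigma_{m,2,2},(u,v,w))$, then $i_r(Q)$ realizes $(\Sigma_{2,2,m},(w,v,u))$, and if $Q$ realizes $(\Sigma_{2,2,m},(w,v,u))$, then $i_r(Q)$ realizes $(\Sigma_{m,2,2},(u,v,w))$. Accordingly, statements (1)–(3) hold with $\Sigma_{2,2,m}$ in place of $\Sigma_{m,2,2}$ and every triple reversed: (1') Suppose that $d\geq 7$. If $(\Sigma_{2,2,m},(u,v,w))$ is realizable, then $u\geq m-3$; exactly $15$ triples of nonnegative integers with $u+v+w=d-2$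 satisfy $u\geq m-3$. (2') For $d\geq 6$, there are exactly $10$ triples of nonnegative integers with $u+v+w=d-2$ and $v+w\leq 3$, and all of them, as well as the triple $(m-3,4,0)$, are realizable with $\Sigma_{2,2,m}$. (3') For $d\geq 6$, the triples $(m-3,0,4)$, $(m-3,1,3)$, $(m-3,2,2)$ and $(m-3,3,1)$ are not realizable with $\Sigma_{2,2,m}$. -/

import Mathlib

open Polynomial

namespace DescartesModuli

/-- The sign pattern `(sgn a_d, sgn a_{d-1}, ..., sgn a_0)` of a real polynomial of degree `d`. -/
noncomputable def signPattern (Q : ℝ[X]) : List SignType :=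
  (List.range (Q.natDegree + 1)).map fun i => SignType.sign (Q.coeff (Q.natDegree - i))

/-- The sign pattern consisting of `m` signs `+`, then `n` signs `-`, then `q` signs `+`. -/
def Sigma3 (m n q : ℕ) : List SignType :=
  List.replicate m 1 ++ List.replicate n (-1) ++ List.replicate q 1

/-- The letters of an order of moduli: `P` marks the modulus of a positive root, `N` the modulus
of a negative root. -/
inductive Letter
  | P
  | N

/-- The letter attached to a (nonzero) real root. -/
noncomputable def letterOf (x : ℝ) : Letter := if 0 < x then Letter.P else Letter.N

/-- The moduli of the real roots of `Q` (counted with multiplicity) are all distinct and, read in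
increasing order, they define the order of moduli `Ω`. -/
def HasOrderOfModuli (Q : ℝ[X]) (Ω : List Letter) : Prop :=
  ∃ l : List ℝ, (l : Multiset ℝ) = Q.roots ∧ l.Pairwise (fun x y => |x| < |y|) ∧
    l.map letterOf = Ω

/-- The order of moduli `(u, v, w)`: `u` letters `N`, one `P`, `v` letters `N`, one `P`,
`w` letters `N`. -/
def tripleOrder (u v w : ℕ) : List Letter :=
  List.replicate u Letter.N ++ [Letter.P] ++ List.replicate v Letter.N ++ [Letter.P] ++
    List.replicate w Letter.N

/-- `Q` is hyperbolic (all its roots are real), defines the sign pattern `σ`, and its roots define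
the order of moduli `Ω`. -/
def Realizes (Q : ℝ[X]) (σ : List SignType) (Ω : List Letter) : Prop :=
  Q.Splits ∧ signPattern Q = σ ∧ HasOrderOfModuli Q Ω

/-- The couple (sign pattern, order of moduli) is realizable. -/
def Realizable (σ : List SignType) (Ω : List Letter) : Prop :=
  ∃ Q : ℝ[X], Realizes Q σ Ω

/-- The involution `Q(x) ↦ x ^ d * Q(1/x) / Q(0)`, where `d` is the degree of `Q`
(used for polynomials with `Q(0) ≠ 0`). -/
noncomputable def invR (Q : ℝ[X]) : ℝ[X] := C (Q.eval 0)⁻¹ * Q.reverse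

/-- The triples `(u, v, w)` of nonnegative integers with `u + v + w = d - 2`, i.e. those which
are orders of moduli of `d` roots, two of which are positive. -/
def triples (d : ℕ) : Set (ℕ × ℕ × ℕ) := {t | t.1 + t.2.1 + t.2.2 + 2 = d}

end DescartesModuli

/-! Let `b < a` be the positive roots and `y_i` the moduli of the negative ones. Up to a positive
factor the polynomial is `-(x - b) p` with `p = (a - x) ∏ (x + y_i)`, so its coefficients are `b p_k
- p_{k-1}`. For `Σ_{m,2,2}` these are positive for `4 ≤ k ≤ d`; since `p_d = 0`, descending in `k`
gives `p_3 < 0` (`coeff_three_neg`).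

If five of the `y_i` are below `a`, comparing elementary symmetric sums gives `p_3 ≥ 0`
(`coeff_three_nonneg`). Hence `u + v ≤ 4`, i.e. `w ≥ m - 3`.

If `u + v = 4` and some `y < b`, write `p = (x + y) p'`. The coefficient of `x^4` is `-p'_2 + (b -
y) p'_3 + b y p'_4`. Here `p'_2 ≥ 0` because three other moduli are below `a`, while `p'_3 < 0` and
`p'_4 ≤ 0`, so positivity fails (`not_realizable_of_add_eq_four`). For `u = 0` no such `y` exists,
and the order is in fact realizable.

Realizability rests on eleven explicit sextics; multiplying by `1 + εx` raises the degree and adds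
one largest negative root (`Realizable.succ`). The reversed pattern follows from `x ↦ 1/x`. -/

namespace DescartesModuli

/-! ### Root lists, coefficients and sign patterns -/

/-- The monic polynomial whose list of roots is `l`. -/
noncomputable def rootProd (l : List ℝ) : ℝ[X] := (l.map fun r => X - C r).prod

@[simp] lemma rootProd_nil : rootProd [] = 1 := by simp [rootProd]

@[simp] lemma rootProd_cons (r : ℝ) (l : List ℝ) :
    rootProd (r :: l) = (X - C r) * rootProd l := by simp [rootProd]

@[simp] lemma rootProd_append (l l' : List ℝ) :
    rootProd (l ++ l') = rootProd l * rootProd l' := by simp [rootProd]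

lemma rootProd_monic (l : List ℝ) : (rootProd l).Monic := by
  induction l with
  | nil => simp
  | cons r l ih => rw [rootProd_cons]; exact (monic_X_sub_C r).mul ih

lemma rootProd_natDegree (l : List ℝ) : (rootProd l).natDegree = l.length := by
  induction l with
  | nil => simp
  | cons r l ih =>
    rw [rootProd_cons, (monic_X_sub_C r).natDegree_mul (rootProd_monic l), ih]
    simp [add_comm]

lemma rootProd_splits (l : List ℝ) : (rootProd l).Splits := by
  induction l with
  | nil => simp
  | cons r l ih => rw [rootProd_cons]; exact (Splits.X_sub_C r).mul ih

lemma rootProd_roots (l : List ℝ) : (rootProd l).roots = l := by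
  have : rootProd l = ((l : Multiset ℝ).map fun r => X - C r).prod := by simp [rootProd]
  rw [this, roots_multiset_prod_X_sub_C]

lemma rootProd_reverse (l : List ℝ) : rootProd l.reverse = rootProd l := by
  induction l with
  | nil => simp
  | cons r l ih => simp [ih, mul_comm]

lemma coeff_zero_X_sub_C_mul (p : ℝ[X]) (r : ℝ) :
    ((X - C r) * p).coeff 0 = -(r * p.coeff 0) := by simp [sub_mul]

lemma coeff_succ_X_sub_C_mul (p : ℝ[X]) (r : ℝ) (k : ℕ) :
    ((X - C r) * p).coeff (k + 1) = p.coeff k - r * p.coeff (k + 1) := by simp [sub_mul]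

lemma realizes_iff {Q : ℝ[X]} {σ : List SignType} {Ω : List Letter} (hQ : Q ≠ 0) :
    Realizes Q σ Ω ↔ ∃ l : List ℝ, Q = C Q.leadingCoeff * rootProd l ∧ signPattern Q = σ ∧
      l.Pairwise (fun x y => |x| < |y|) ∧ l.map letterOf = Ω := by
  constructor
  · rintro ⟨h1, h2, l, h3, h4, h5⟩
    refine ⟨l, ?_, h2, h4, h5⟩
    have := h1.eq_prod_roots
    rw [← h3] at this
    simpa [rootProd] using this
  · rintro ⟨l, h1, h2, h3, h4⟩
    refine ⟨?_, h2, l, ?_, h3, h4⟩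
    · rw [h1]; exact (Splits.C _).mul (rootProd_splits l)
    · rw [h1, roots_C_mul _ (leadingCoeff_ne_zero.2 hQ), rootProd_roots]

lemma signPattern_eq_iff {Q : ℝ[X]} {m n q : ℕ} :
    signPattern Q = Sigma3 m n q ↔ Q.natDegree + 1 = m + n + q ∧ ∀ k < m + n + q,
      SignType.sign (Q.coeff k) = if k < q then 1 else if k < q + n then -1 else 1 := by
  constructor
  · intro h
    have hl : Q.natDegree + 1 = m + n + q := by
      have := congrArg List.length h
      simp [signPattern, Sigma3] at this
      omega
    refine ⟨hl, fun k hk => ?_⟩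
    have h1 := congrArg (fun l => l[Q.natDegree - k]?) h
    have h2 : Q.natDegree - (Q.natDegree - k) = k := by omega
    have h3 : Q.natDegree - k < Q.natDegree + 1 := by omega
    simp only [signPattern, Sigma3, List.getElem?_map, List.getElem?_range h3, Option.map_some, h2,
      List.getElem?_append, List.length_append, List.length_replicate,
      List.getElem?_replicate] at h1
    split_ifs at h1 ⊢ <;> first | omega | simpa using h1
  · rintro ⟨hl, h⟩
    apply List.ext_getElem?
    intro i
    by_cases hi : i < Q.natDegree + 1
    · have h1 := h (Q.natDegree - i) (by omega)
      simp only [signPattern, Sigma3, List.getElem?_map, List.getElem?_range hi, Option.map_some,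
        List.getElem?_append, List.length_append, List.length_replicate,
        List.getElem?_replicate]
      split_ifs at h1 ⊢ <;> first | omega | simpa using h1
    · rw [List.getElem?_eq_none, List.getElem?_eq_none] <;>
        simp [signPattern, Sigma3] <;> omega

lemma coeff_pos_of_signPattern {Q : ℝ[X]} {m n q k : ℕ} (h : signPattern Q = Sigma3 m n q)
    (hk : k < q ∨ q + n ≤ k ∧ k < m + n + q) : 0 < Q.coeff k := by
  have := (signPattern_eq_iff.1 h).2 k (by omega)
  rw [← sign_eq_one_iff, this]
  split_ifs <;> first | rfl | omega

/-! ### The involution -/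

lemma invR_natDegree {Q : ℝ[X]} (h : 0 < Q.coeff 0) : (invR Q).natDegree = Q.natDegree := by
  have h0 : Q.eval 0 ≠ 0 := by rw [← coeff_zero_eq_eval_zero]; exact h.ne'
  rw [invR, natDegree_C_mul (inv_ne_zero h0), reverse_natDegree,
    natTrailingDegree_eq_zero.2 (Or.inr h.ne'), Nat.sub_zero]

lemma invR_coeff {Q : ℝ[X]} {k : ℕ} (hk : k ≤ Q.natDegree) :
    (invR Q).coeff k = (Q.coeff 0)⁻¹ * Q.coeff (Q.natDegree - k) := by
  rw [invR, coeff_C_mul, coeff_reverse, revAt_le hk, coeff_zero_eq_eval_zero]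

lemma invR_signPattern {Q : ℝ[X]} {m n q : ℕ} (hq : 0 < q)
    (h : signPattern Q = Sigma3 m n q) : signPattern (invR Q) = Sigma3 q n m := by
  have h0 : 0 < Q.coeff 0 := coeff_pos_of_signPattern h (Or.inl hq)
  obtain ⟨hd, hs⟩ := signPattern_eq_iff.1 h
  rw [signPattern_eq_iff, invR_natDegree h0]
  refine ⟨by omega, fun k hk => ?_⟩
  rw [invR_coeff (by omega), sign_mul, sign_pos (inv_pos.2 h0), one_mul, hs _ (by omega)]
  split_ifs <;> first | rfl | omega

/-- The reversal of `X - r` is `1 - rX = -r (X - r⁻¹)`, and reversal is multiplicative over a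
domain. -/
lemma reverse_rootProd {l : List ℝ} (h : ∀ r ∈ l, r ≠ 0) :
    ∃ c : ℝ, c ≠ 0 ∧ (rootProd l).reverse = C c * rootProd (l.map (·⁻¹)) := by
  induction l with
  | nil => exact ⟨1, one_ne_zero, by simpa using reverse_C (1 : ℝ)⟩
  | cons r l ih =>
    obtain ⟨c, hc, hl⟩ := ih fun x hx => h x (List.mem_cons_of_mem _ hx)
    have hr : r ≠ 0 := h r List.mem_cons_self
    refine ⟨-r * c, mul_ne_zero (neg_ne_zero.2 hr) hc, ?_⟩
    have h1 : (X - C r : ℝ[X]).reverse = C (-r) * (X - C r⁻¹) := by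
      have h1 : (X - C r : ℝ[X]).natDegree = 1 := natDegree_X_sub_C r
      ext k
      rw [coeff_reverse, h1, coeff_C_mul]
      rcases k with _ | _ | k
      · simp [revAt_le, hr]
      · simp [revAt_le]
      · rw [revAt_eq_self_of_lt (by omega)]
        simp [coeff_X]
    rw [rootProd_cons, reverse_mul_of_domain, h1, hl, List.map_cons, rootProd_cons, C_mul]
    ring

lemma letterOf_inv (x : ℝ) : letterOf x⁻¹ = letterOf x := by simp [letterOf]

lemma tripleOrder_reverse (u v w : ℕ) : (tripleOrder u v w).reverse = tripleOrder w v u := by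
  simp [tripleOrder]

/-- Inverting the roots keeps their signs and reverses their moduli, so the inverted list must be
read backwards. The last sign `+` (`0 < q`) excludes the root `0`. -/
lemma Realizes.invR {Q : ℝ[X]} {m n q u v w : ℕ} (hq : 0 < q)
    (h : Realizes Q (Sigma3 m n q) (tripleOrder u v w)) :
    Realizes (invR Q) (Sigma3 q n m) (tripleOrder w v u) := by
  have h0 : 0 < Q.coeff 0 := coeff_pos_of_signPattern h.2.1 (Or.inl hq)
  have hQ : Q ≠ 0 := by rintro rfl; simp at h0
  obtain ⟨l, hl, hs, hp, ho⟩ := (realizes_iff hQ).1 h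
  have hl0 : ∀ r ∈ l, r ≠ 0 := by
    rintro r hr rfl
    have : rootProd l ∣ Q := hl ▸ dvd_mul_left _ _
    have h2 : (X - C (0 : ℝ)) ∣ rootProd l := List.dvd_prod (List.mem_map_of_mem hr)
    have h3 := dvd_iff_isRoot.1 (h2.trans this)
    rw [IsRoot, ← coeff_zero_eq_eval_zero] at h3
    exact h0.ne' h3
  obtain ⟨c, hc, hr⟩ := reverse_rootProd hl0
  have e : DescartesModuli.invR Q =
      C ((Q.eval 0)⁻¹ * (Q.leadingCoeff * c)) * rootProd (l.map (·⁻¹)).reverse := by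
    rw [rootProd_reverse, DescartesModuli.invR]
    conv_lhs => rw [hl]
    rw [reverse_mul_of_domain, reverse_C, hr]
    rw [← hl, C_mul, C_mul]; ring
  have hne : DescartesModuli.invR Q ≠ 0 := by
    rw [e]
    refine mul_ne_zero (C_ne_zero.2 (mul_ne_zero (inv_ne_zero ?_)
      (mul_ne_zero (leadingCoeff_ne_zero.2 hQ) hc))) (rootProd_monic _).ne_zero
    rw [← coeff_zero_eq_eval_zero]; exact h0.ne'
  rw [realizes_iff hne]
  refine ⟨(l.map (·⁻¹)).reverse, ?_, invR_signPattern hq hs, ?_, ?_⟩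
  · have : (DescartesModuli.invR Q).leadingCoeff =
        (Q.eval 0)⁻¹ * (Q.leadingCoeff * c) := by
      rw [e, leadingCoeff_mul, (rootProd_monic _).leadingCoeff, leadingCoeff_C, mul_one]
    rw [this, e]
  · rw [List.pairwise_reverse, List.pairwise_map]
    refine hp.imp_of_mem fun {a b} ha hb hab => ?_
    rw [abs_inv, abs_inv]
    exact inv_strictAnti₀ (abs_pos.2 (hl0 a ha)) hab
  · rw [← tripleOrder_reverse u v w, ← ho, List.map_reverse, List.map_map]
    congr 2
    funext x
    exact letterOf_inv x

lemma realizable_reverse_iff {m n q u v w : ℕ} (hm : 0 < m) (hq : 0 < q) :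
    Realizable (Sigma3 q n m) (tripleOrder w v u) ↔
      Realizable (Sigma3 m n q) (tripleOrder u v w) :=
  ⟨fun ⟨_, h⟩ => ⟨_, h.invR hm⟩, fun ⟨_, h⟩ => ⟨_, h.invR hq⟩⟩

/-! ### Nonrealizability -/

/-- Multiplying by `X + y` with `y > 0` makes coefficient `k` depend only on coefficients `k - 1`
and `k`, so nonnegativity up to `n` survives whatever the higher coefficients are. -/
lemma coeff_nonneg_mul_rootProd {p : ℝ[X]} {n : ℕ} {l : List ℝ} (hl : ∀ r ∈ l, r < 0)
    (hp : ∀ k ≤ n, 0 ≤ p.coeff k) : ∀ k ≤ n, 0 ≤ (p * rootProd l).coeff k := by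
  induction l with
  | nil => simpa using hp
  | cons r l ih =>
    have ih := ih fun x hx => hl x (List.mem_cons_of_mem _ hx)
    have hr : r < 0 := hl r List.mem_cons_self
    intro k hk
    rw [rootProd_cons, mul_left_comm]
    cases k with
    | zero =>
      rw [coeff_zero_X_sub_C_mul]
      nlinarith [ih 0 hk]
    | succ k =>
      rw [coeff_succ_X_sub_C_mul]
      nlinarith [ih k (by omega), ih (k + 1) hk]

/-- Once a coefficient of `(a - X) * ∏ (X - r)` (with `a > 0` and all `r < 0`) is nonpositive,
so is the next one. -/
lemma coeff_succ_nonpos {a : ℝ} (ha : 0 < a) {l : List ℝ} (hl : ∀ r ∈ l, r < 0) (k : ℕ)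
    (hk : ((C a - X) * rootProd l).coeff k ≤ 0) :
    ((C a - X) * rootProd l).coeff (k + 1) ≤ 0 := by
  induction l generalizing k with
  | nil =>
    rcases k with _ | _ | k
    · simp at hk; linarith
    · simp [coeff_X]
    · simp [coeff_X]
  | cons r l ih =>
    have ih := ih fun x hx => hl x (List.mem_cons_of_mem _ hx)
    have hr : r < 0 := hl r List.mem_cons_self
    rw [rootProd_cons, mul_left_comm] at hk ⊢
    set p := (C a - X) * rootProd l
    rw [coeff_succ_X_sub_C_mul]
    cases k with
    | zero =>
      rw [coeff_zero_X_sub_C_mul] at hk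
      have h0 : p.coeff 0 ≤ 0 := by nlinarith
      nlinarith [ih 0 h0]
    | succ k =>
      rw [coeff_succ_X_sub_C_mul] at hk
      have h0 : p.coeff (k + 1) ≤ 0 := by
        -- If `p_{k+1} > 0`, the induction hypothesis forces `p_k > 0`, so `p_k - r p_{k+1}` could
        -- not be nonpositive.
        by_contra hpos
        push Not at hpos
        have : ¬ p.coeff k ≤ 0 := fun h => hpos.not_ge (ih k h)
        nlinarith
      nlinarith [ih (k + 1) h0]

/-- Five small moduli suffice: coefficient `k` of `(a - x) ∏ (x + y_i)` over these five is `a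
e_{5-k} - e_{6-k}`, nonnegative for `k ≤ 3`. The other negative roots preserve this. -/
lemma coeff_three_nonneg {a : ℝ} {l l' : List ℝ} (hlen : 5 ≤ l.length)
    (hl : ∀ r ∈ l, r < 0 ∧ -r < a) (hl' : ∀ r ∈ l', r < 0) :
    0 ≤ ((C a - X) * rootProd (l ++ l')).coeff 3 := by
  obtain ⟨x₁, x₂, x₃, x₄, x₅, t, rfl⟩ : ∃ x₁ x₂ x₃ x₄ x₅ t, l = x₁ :: x₂ :: x₃ :: x₄ :: x₅ :: t := by
    match l, hlen with
    | x₁ :: x₂ :: x₃ :: x₄ :: x₅ :: t, _ => exact ⟨_, _, _, _, _, _, rfl⟩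
  have e : (C a - X) * rootProd (x₁ :: x₂ :: x₃ :: x₄ :: x₅ :: t ++ l') =
      ((X - C x₁) * ((X - C x₂) * ((X - C x₃) * ((X - C x₄) * ((X - C x₅) * (C a - X)))))) *
        rootProd (t ++ l') := by
    simp; ring
  rw [e]
  have hx₁ := hl x₁ (by simp)
  have hx₂ := hl x₂ (by simp)
  have hx₃ := hl x₃ (by simp)
  have hx₄ := hl x₄ (by simp)
  have hx₅ := hl x₅ (by simp)
  refine coeff_nonneg_mul_rootProd (n := 3) ?_ ?_ 3 le_rfl
  · intro r hr
    rcases List.mem_append.1 hr with h | h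
    · exact (hl r (by simp [h])).1
    · exact hl' r h
  obtain ⟨y₁, rfl⟩ : ∃ y, x₁ = -y := ⟨-x₁, by ring⟩
  obtain ⟨y₂, rfl⟩ : ∃ y, x₂ = -y := ⟨-x₂, by ring⟩
  obtain ⟨y₃, rfl⟩ : ∃ y, x₃ = -y := ⟨-x₃, by ring⟩
  obtain ⟨y₄, rfl⟩ : ∃ y, x₄ = -y := ⟨-x₄, by ring⟩
  obtain ⟨y₅, rfl⟩ : ∃ y, x₅ = -y := ⟨-x₅, by ring⟩
  simp only [neg_neg, Left.neg_neg_iff] at hx₁ hx₂ hx₃ hx₄ hx₅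
  obtain ⟨hy₁, ha₁⟩ := hx₁
  obtain ⟨hy₂, ha₂⟩ := hx₂
  obtain ⟨hy₃, ha₃⟩ := hx₃
  obtain ⟨hy₄, ha₄⟩ := hx₄
  obtain ⟨hy₅, ha₅⟩ := hx₅
  have ha : 0 < a := hy₁.trans ha₁
  -- Summed over the ten pairs, `key` gives `3 (a e_2 - e_3)`, each triple being counted three
  -- times. Summed over the ten triples, `key'` gives `2 a e_3 - 4 e_4`, which with `e_4 > 0` yields
  -- `a e_3 - e_4 ≥ 0`.
  have key : ∀ {p q r s t : ℝ}, 0 < p → 0 < q → r < a → s < a → t < a →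
      0 ≤ p * q * (3 * a - r - s - t) := fun hp hq h1 h2 h3 =>
    mul_nonneg (mul_pos hp hq).le (by linarith)
  have key' : ∀ {p q r s t : ℝ}, 0 < p → 0 < q → 0 < r → s < a → t < a →
      0 ≤ p * q * r * (2 * a - s - t) := fun hp hq hr h1 h2 =>
    mul_nonneg (mul_pos (mul_pos hp hq) hr).le (by linarith)
  intro k hk
  interval_cases k
  · simp only [coeff_zero_X_sub_C_mul]
    simp
    positivity
  · simp only [coeff_zero_X_sub_C_mul, coeff_succ_X_sub_C_mul]
    simp [coeff_X, coeff_C]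
    nlinarith [mul_nonneg (mul_pos (mul_pos (mul_pos hy₁ hy₂) hy₃) hy₄).le (sub_pos.2 ha₅).le,
      mul_pos (mul_pos (mul_pos (mul_pos hy₁ hy₂) hy₃) hy₅) ha,
      mul_pos (mul_pos (mul_pos (mul_pos hy₁ hy₂) hy₄) hy₅) ha,
      mul_pos (mul_pos (mul_pos (mul_pos hy₁ hy₃) hy₄) hy₅) ha,
      mul_pos (mul_pos (mul_pos (mul_pos hy₂ hy₃) hy₄) hy₅) ha]
  · simp only [coeff_zero_X_sub_C_mul, coeff_succ_X_sub_C_mul]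
    simp [coeff_X, coeff_C]
    linarith [key' hy₁ hy₂ hy₃ ha₄ ha₅, key' hy₁ hy₂ hy₄ ha₃ ha₅, key' hy₁ hy₂ hy₅ ha₃ ha₄,
      key' hy₁ hy₃ hy₄ ha₂ ha₅, key' hy₁ hy₃ hy₅ ha₂ ha₄, key' hy₁ hy₄ hy₅ ha₂ ha₃,
      key' hy₂ hy₃ hy₄ ha₁ ha₅, key' hy₂ hy₃ hy₅ ha₁ ha₄, key' hy₂ hy₄ hy₅ ha₁ ha₃,
      key' hy₃ hy₄ hy₅ ha₁ ha₂,
      mul_pos (mul_pos (mul_pos hy₁ hy₂) hy₃) hy₄, mul_pos (mul_pos (mul_pos hy₁ hy₂) hy₃) hy₅,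
      mul_pos (mul_pos (mul_pos hy₁ hy₂) hy₄) hy₅, mul_pos (mul_pos (mul_pos hy₁ hy₃) hy₄) hy₅,
      mul_pos (mul_pos (mul_pos hy₂ hy₃) hy₄) hy₅]
  · simp only [coeff_zero_X_sub_C_mul, coeff_succ_X_sub_C_mul]
    simp [coeff_X, coeff_C]
    linarith [key hy₁ hy₂ ha₃ ha₄ ha₅, key hy₁ hy₃ ha₂ ha₄ ha₅, key hy₁ hy₄ ha₂ ha₃ ha₅,
      key hy₁ hy₅ ha₂ ha₃ ha₄, key hy₂ hy₃ ha₁ ha₄ ha₅, key hy₂ hy₄ ha₁ ha₃ ha₅,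
      key hy₂ hy₅ ha₁ ha₃ ha₄, key hy₃ hy₄ ha₁ ha₂ ha₅, key hy₃ hy₅ ha₁ ha₂ ha₄,
      key hy₄ hy₅ ha₁ ha₂ ha₃]

/-- The analogue with three small moduli, where the top case is `a e_1 - e_2 ≥ 0`. -/
lemma coeff_two_nonneg {a : ℝ} {l l' : List ℝ} (hlen : 3 ≤ l.length)
    (hl : ∀ r ∈ l, r < 0 ∧ -r < a) (hl' : ∀ r ∈ l', r < 0) :
    0 ≤ ((C a - X) * rootProd (l ++ l')).coeff 2 := by
  obtain ⟨x₁, x₂, x₃, t, rfl⟩ : ∃ x₁ x₂ x₃ t, l = x₁ :: x₂ :: x₃ :: t := by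
    match l, hlen with
    | x₁ :: x₂ :: x₃ :: t, _ => exact ⟨_, _, _, _, rfl⟩
  have e : (C a - X) * rootProd (x₁ :: x₂ :: x₃ :: t ++ l') =
      ((X - C x₁) * ((X - C x₂) * ((X - C x₃) * (C a - X)))) * rootProd (t ++ l') := by
    simp; ring
  rw [e]
  obtain ⟨hx₁, ha₁⟩ := hl x₁ (by simp)
  obtain ⟨hx₂, ha₂⟩ := hl x₂ (by simp)
  obtain ⟨hx₃, ha₃⟩ := hl x₃ (by simp)
  refine coeff_nonneg_mul_rootProd (n := 2) ?_ ?_ 2 le_rfl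
  · intro r hr
    rcases List.mem_append.1 hr with h | h
    · exact (hl r (by simp [h])).1
    · exact hl' r h
  have ha : 0 < a := by linarith
  have h12 := mul_pos_of_neg_of_neg hx₁ hx₂
  have h13 := mul_pos_of_neg_of_neg hx₁ hx₃
  have h23 := mul_pos_of_neg_of_neg hx₂ hx₃
  intro k hk
  interval_cases k
  · simp only [coeff_zero_X_sub_C_mul]
    simp
    nlinarith [mul_pos (mul_pos h12 (neg_pos.2 hx₃)) ha]
  · simp only [coeff_zero_X_sub_C_mul, coeff_succ_X_sub_C_mul]
    simp [coeff_X, coeff_C]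
    nlinarith [mul_pos h12 (by linarith : 0 < a + x₃), mul_pos h13 ha, mul_pos h23 ha]
  · simp only [coeff_zero_X_sub_C_mul, coeff_succ_X_sub_C_mul]
    simp [coeff_X, coeff_C]
    nlinarith [mul_pos (neg_pos.2 hx₁) (by linarith : 0 < 2 * a + x₂ + x₃),
      mul_pos (neg_pos.2 hx₂) (by linarith : 0 < 2 * a + x₁ + x₃),
      mul_pos (neg_pos.2 hx₃) (by linarith : 0 < 2 * a + x₁ + x₂)]

/-- The positive roots `b < a` and the three groups of negative roots of a polynomial realizing
an order of moduli with two positive roots, together with the signs of the coefficients. -/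
lemma exists_factorization {m u v w : ℕ} (hm : 0 < m)
    (h : Realizable (Sigma3 m 2 2) (tripleOrder u v w)) :
    ∃ (a b : ℝ) (l₁ l₂ l₃ : List ℝ), 0 < b ∧ 0 < a ∧ l₁.length = u ∧ l₂.length = v ∧
      l₃.length = w ∧
      (∀ r ∈ l₁, r < 0 ∧ -r < a ∧ -r < b) ∧ (∀ r ∈ l₂, r < 0 ∧ -r < a) ∧ (∀ r ∈ l₃, r < 0) ∧
      u + v + w = m + 1 ∧
      (∀ k, 4 ≤ k → k < m + 4 →
        0 < ((X - C b) * ((X - C a) * rootProd (l₁ ++ l₂ ++ l₃))).coeff k) := by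
  obtain ⟨Q, hQ⟩ := h
  have h0 : 0 < Q.coeff 0 := coeff_pos_of_signPattern hQ.2.1 (Or.inl two_pos)
  have hQ0 : Q ≠ 0 := by rintro rfl; simp at h0
  obtain ⟨l, hl, hs, hp, ho⟩ := (realizes_iff hQ0).1 hQ
  have hd := (signPattern_eq_iff.1 hs).1
  have hlc : 0 < Q.leadingCoeff :=
    coeff_pos_of_signPattern (k := Q.natDegree) hs (Or.inr (by omega))
  have hlen : l.length = u + v + w + 2 := by
    have := congrArg List.length ho
    simp [tripleOrder] at this
    omega
  have hdeg : Q.natDegree = l.length := by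
    have := congrArg natDegree hl
    rwa [natDegree_C_mul hlc.ne', rootProd_natDegree] at this
  rw [tripleOrder, List.map_eq_append_iff] at ho
  obtain ⟨l', l₃, rfl, ho, h₃⟩ := ho
  rw [List.map_eq_append_iff] at ho
  obtain ⟨l', la, rfl, ho, ha⟩ := ho
  rw [List.map_eq_append_iff] at ho
  obtain ⟨l', l₂, rfl, ho, h₂⟩ := ho
  rw [List.map_eq_append_iff] at ho
  obtain ⟨l₁, lb, rfl, h₁, hb⟩ := ho
  obtain ⟨a, rfl⟩ : ∃ a, la = [a] := List.length_eq_one_iff.1 (by simpa using congrArg List.length ha)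
  obtain ⟨b, rfl⟩ : ∃ b, lb = [b] := List.length_eq_one_iff.1 (by simpa using congrArg List.length hb)
  have hpos : ∀ {x : ℝ}, [x].map letterOf = [Letter.P] → 0 < x := by
    intro x hx
    by_contra hn
    simp [letterOf, hn] at hx
  -- `letterOf 0` is `N`, so the letter alone does not make a root negative; zero is excluded by the
  -- positive constant term.
  have hroot : ∀ r ∈ l₁ ++ [b] ++ l₂ ++ [a] ++ l₃, r ≠ 0 := by
    rintro r hr rfl
    have h1 : rootProd (l₁ ++ [b] ++ l₂ ++ [a] ++ l₃) ∣ Q := hl ▸ dvd_mul_left _ _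
    have h2 : (X - C (0 : ℝ)) ∣ rootProd (l₁ ++ [b] ++ l₂ ++ [a] ++ l₃) :=
      List.dvd_prod (List.mem_map_of_mem hr)
    have h3 := dvd_iff_isRoot.1 (h2.trans h1)
    rw [IsRoot, ← coeff_zero_eq_eval_zero] at h3
    exact h0.ne' h3
  have hneg : ∀ {k : ℕ} {t : List ℝ}, t.map letterOf = List.replicate k Letter.N →
      t ⊆ l₁ ++ [b] ++ l₂ ++ [a] ++ l₃ → ∀ r ∈ t, r < 0 := by
    intro k t ht hsub r hr
    have h1 : letterOf r = Letter.N := by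
      have : letterOf r ∈ t.map letterOf := List.mem_map_of_mem hr
      rw [ht] at this
      exact List.eq_of_mem_replicate this
    refine lt_of_le_of_ne ?_ (hroot r (hsub hr))
    by_contra hn
    push Not at hn
    simp [letterOf, hn] at h1
  have ha := hpos ha
  have hb := hpos hb
  have hn₁ := hneg h₁ (by intro x hx; simp [hx])
  have hn₂ := hneg h₂ (by intro x hx; simp [hx])
  have hn₃ := hneg h₃ (by intro x hx; simp [hx])
  simp only [List.pairwise_append, List.mem_append, List.mem_singleton] at hp
  refine ⟨a, b, l₁, l₂, l₃, hb, ha, by simpa using congrArg List.length h₁,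
    by simpa using congrArg List.length h₂, by simpa using congrArg List.length h₃, ?_, ?_, hn₃,
    by omega, ?_⟩
  · intro r hr
    refine ⟨hn₁ r hr, ?_, ?_⟩
    · have := hp.1.2.2 r (Or.inl (Or.inl hr)) a rfl
      rwa [abs_of_neg (hn₁ r hr), abs_of_pos ha] at this
    · have := hp.1.1.1.2.2 r hr b rfl
      rwa [abs_of_neg (hn₁ r hr), abs_of_pos hb] at this
  · intro r hr
    refine ⟨hn₂ r hr, ?_⟩
    have := hp.1.2.2 r (Or.inr hr) a rfl
    rwa [abs_of_neg (hn₂ r hr), abs_of_pos ha] at this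
  · intro k hk hk'
    have h1 := coeff_pos_of_signPattern (k := k) hs (Or.inr (by omega))
    rw [hl, coeff_C_mul] at h1
    have h2 := pos_of_mul_pos_right h1 hlc.le
    have e : rootProd (l₁ ++ [b] ++ l₂ ++ [a] ++ l₃) =
        (X - C b) * ((X - C a) * rootProd (l₁ ++ l₂ ++ l₃)) := by simp; ring
    rwa [e] at h2

/-- With `p = (a - X) * rootProd l`, positivity reads `b p_k > p_{k-1}`. If `p_3 ≥ 0`, positivity
climbs from `p_4` to `p_{n+1}`, which lies beyond the degree of `p`. -/
lemma coeff_three_neg {a b : ℝ} (hb : 0 < b) {l : List ℝ} {n : ℕ} (hl : l.length < n) (hn : 3 ≤ n)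
    (h : ∀ k, 4 ≤ k → k ≤ n + 1 → 0 < ((X - C b) * ((X - C a) * rootProd l)).coeff k) :
    ((C a - X) * rootProd l).coeff 3 < 0 := by
  have e : (X - C a) * rootProd l = -((C a - X) * rootProd l) := by ring
  rw [e] at h
  have hdeg : ((C a - X) * rootProd l).natDegree < n + 1 := by
    rw [← natDegree_neg, ← e, ← rootProd_cons, rootProd_natDegree]
    simpa using hl
  set p := (C a - X) * rootProd l
  by_contra h3
  push Not at h3
  have hk : ∀ k, 3 ≤ k → k ≤ n → 0 ≤ p.coeff k ∧ 0 < p.coeff (k + 1) := by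
    intro k hk
    induction k, hk using Nat.le_induction with
    | base =>
      intro _
      have := h 4 le_rfl (by omega)
      rw [coeff_succ_X_sub_C_mul, coeff_neg, coeff_neg] at this
      refine ⟨h3, pos_of_mul_pos_right (a := b) ?_ hb.le⟩
      norm_num at this ⊢
      linarith
    | succ k hk ih =>
      intro hk'
      have hi := (ih (by omega)).2
      have := h (k + 1 + 1) (by omega) (by omega)
      rw [coeff_succ_X_sub_C_mul, coeff_neg, coeff_neg] at this
      exact ⟨hi.le, pos_of_mul_pos_right (a := b) (by linarith) hb.le⟩
  have h1 := (hk n hn le_rfl).2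
  rw [coeff_eq_zero_of_natDegree_lt hdeg] at h1
  exact h1.false

theorem add_le_four_of_realizable {m u v w : ℕ} (hm : 3 ≤ m)
    (h : Realizable (Sigma3 m 2 2) (tripleOrder u v w)) : u + v ≤ 4 := by
  obtain ⟨a, b, l₁, l₂, l₃, hb, ha, hu, hv, hw, h₁, h₂, h₃, hs, hc⟩ :=
    exists_factorization (by omega) h
  by_contra hlt
  have h3 := coeff_three_neg hb (l := l₁ ++ l₂ ++ l₃) (n := m + 2) (by simp; omega) (by omega)
    fun k hk hk' => hc k hk (by omega)
  refine h3.not_ge (coeff_three_nonneg (by simp; omega) ?_ h₃)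
  intro r hr
  rcases List.mem_append.1 hr with hr | hr
  · exact ⟨(h₁ r hr).1, (h₁ r hr).2.1⟩
  · exact h₂ r hr

theorem not_realizable_of_add_eq_four {m u v w : ℕ} (hm : 3 ≤ m) (hu : 0 < u) (huv : u + v = 4) :
    ¬ Realizable (Sigma3 m 2 2) (tripleOrder u v w) := by
  intro h
  obtain ⟨a, b, l₁, l₂, l₃, hb, ha, hl₁, hv, hw, h₁, h₂, h₃, hs, hc⟩ :=
    exists_factorization (by omega) h
  have h3 := coeff_three_neg hb (l := l₁ ++ l₂ ++ l₃) (n := m + 2) (by simp; omega) (by omega)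
    fun k hk hk' => hc k hk (by omega)
  have h4 := hc 4 le_rfl (by omega)
  obtain ⟨r, t, rfl⟩ : ∃ r t, l₁ = r :: t := List.exists_cons_of_length_pos (by omega)
  obtain ⟨hr, hra, hrb⟩ := h₁ r List.mem_cons_self
  have hneg : ∀ x ∈ t ++ l₂ ++ l₃, x < 0 := by
    intro x hx
    simp only [List.mem_append] at hx
    rcases hx with (hx | hx) | hx
    · exact (h₁ x (List.mem_cons_of_mem _ hx)).1
    · exact (h₂ x hx).1
    · exact h₃ x hx
  have h2 : 0 ≤ ((C a - X) * rootProd (t ++ l₂ ++ l₃)).coeff 2 := by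
    refine coeff_two_nonneg (by simp at hl₁ ⊢; omega) ?_ h₃
    intro x hx
    rcases List.mem_append.1 hx with hx | hx
    · have := h₁ x (List.mem_cons_of_mem _ hx)
      exact ⟨this.1, this.2.1⟩
    · exact h₂ x hx
  have e₁ : (C a - X) * rootProd (r :: t ++ l₂ ++ l₃) =
      (X - C r) * ((C a - X) * rootProd (t ++ l₂ ++ l₃)) := by simp; ring
  have e₂ : (X - C b) * ((X - C a) * rootProd (r :: t ++ l₂ ++ l₃)) =
      -((X - C b) * ((X - C r) * ((C a - X) * rootProd (t ++ l₂ ++ l₃)))) := by simp; ring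
  have hn := coeff_succ_nonpos ha hneg 3
  rw [e₁] at h3
  rw [e₂, coeff_neg] at h4
  set p := (C a - X) * rootProd (t ++ l₂ ++ l₃)
  simp only [coeff_succ_X_sub_C_mul] at h3 h4
  norm_num at h3 h4 hn
  have h3' : p.coeff 3 < 0 := by nlinarith
  have h4' := hn h3'.le
  -- The hints add up to `-(b + r) p_3 + b r p_4 ≥ 0`; with `p_2 ≥ 0` this contradicts `h4`. Here `b
  -- + r > 0` is the assumption that the modulus `-r` is below `b`.
  nlinarith [mul_nonneg (by linarith : 0 ≤ b + r) (by nlinarith : 0 ≤ r * p.coeff 4 - p.coeff 3),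
    mul_nonneg (sq_nonneg r) (neg_nonneg.2 h4')]

/-! ### Realizability -/

-- For small `ε > 0`, `Q (1 + εX)` keeps the nonzero signs of the coefficients of `Q`, gains a
-- positive leading coefficient, and gains the root `-1/ε`, larger in modulus than all others.
open Filter Topology in
lemma Realizable.succ {m n q u v w : ℕ} (hm : 0 < m) (hq : 0 < q)
    (h : Realizable (Sigma3 m n q) (tripleOrder u v w)) :
    Realizable (Sigma3 (m + 1) n q) (tripleOrder u v (w + 1)) := by
  obtain ⟨Q, hQ⟩ := h
  have h0 : 0 < Q.coeff 0 := coeff_pos_of_signPattern hQ.2.1 (Or.inl hq)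
  have hQ0 : Q ≠ 0 := by rintro rfl; simp at h0
  obtain ⟨l, hl, hs, hp, ho⟩ := (realizes_iff hQ0).1 hQ
  obtain ⟨hd, hsgn⟩ := signPattern_eq_iff.1 hs
  have hlc : 0 < Q.leadingCoeff :=
    coeff_pos_of_signPattern (k := Q.natDegree) hs (Or.inr (by omega))
  have ev₁ : ∀ᶠ ε : ℝ in 𝓝[>] 0, ∀ k ∈ Finset.range (m + n + q),
      SignType.sign (Q.coeff k + ε * (X * Q).coeff k) = SignType.sign (Q.coeff k) := by
    rw [Filter.eventually_all_finset]
    intro k hk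
    have hne : Q.coeff k ≠ 0 := by
      have := hsgn k (Finset.mem_range.1 hk)
      rw [← sign_ne_zero, this]
      split_ifs <;> decide
    have ht : Tendsto (fun ε : ℝ => Q.coeff k + ε * (X * Q).coeff k) (𝓝[>] 0)
        (𝓝 (Q.coeff k)) := by
      have : Continuous fun ε : ℝ => Q.coeff k + ε * (X * Q).coeff k := by fun_prop
      simpa using (this.tendsto 0).mono_left nhdsWithin_le_nhds
    rcases hne.lt_or_gt with hlt | hgt
    · filter_upwards [ht.eventually_lt_const hlt] with ε hε
      rw [sign_neg hε, sign_neg hlt]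
    · filter_upwards [ht.eventually_const_lt hgt] with ε hε
      rw [sign_pos hε, sign_pos hgt]
  have ev₂ : ∀ᶠ ε : ℝ in 𝓝[>] 0, ∀ r ∈ l.toFinset, ε * |r| < 1 := by
    rw [Filter.eventually_all_finset]
    intro r _
    have ht : Tendsto (fun ε : ℝ => ε * |r|) (𝓝[>] 0) (𝓝 0) := by
      have : Continuous fun ε : ℝ => ε * |r| := by fun_prop
      simpa using (this.tendsto 0).mono_left nhdsWithin_le_nhds
    exact ht.eventually_lt_const one_pos
  obtain ⟨ε, hε₁, hε₂, hε⟩ := (ev₁.and (ev₂.and self_mem_nhdsWithin)).exists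
  have hε : 0 < ε := hε
  set c := ε * Q.leadingCoeff
  have hc : 0 < c := mul_pos hε hlc
  -- Scaling by `c = ε * Q.leadingCoeff` makes the product a small perturbation of `Q`, to which the
  -- sign estimates apply.
  have e : C c * rootProd (l ++ [-ε⁻¹]) = Q + C ε * (X * Q) := by
    have : C ε * C ε⁻¹ = (1 : ℝ[X]) := by rw [← C_mul, mul_inv_cancel₀ hε.ne', C_1]
    conv_rhs => rw [hl]
    simp only [c, rootProd_append, rootProd_cons, rootProd_nil, C_mul, C_neg]
    linear_combination (C Q.leadingCoeff * rootProd l) * this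
  have hlen : l.length + 1 = m + n + q := by
    have := congrArg natDegree hl
    rw [natDegree_C_mul hlc.ne', rootProd_natDegree] at this
    omega
  have hlead : (C c * rootProd (l ++ [-ε⁻¹])).leadingCoeff = c := by
    rw [leadingCoeff_mul, (rootProd_monic _).leadingCoeff, leadingCoeff_C, mul_one]
  have hdeg : (C c * rootProd (l ++ [-ε⁻¹])).natDegree = l.length + 1 := by
    rw [natDegree_C_mul hc.ne', rootProd_natDegree]; simp
  refine ⟨C c * rootProd (l ++ [-ε⁻¹]),
    (realizes_iff (leadingCoeff_ne_zero.1 (by rw [hlead]; exact hc.ne'))).2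
      ⟨l ++ [-ε⁻¹], by rw [hlead], signPattern_eq_iff.2 ⟨by rw [hdeg]; omega, ?_⟩, ?_, ?_⟩⟩
  · intro k hk
    rcases Nat.lt_or_ge k (m + n + q) with hlt | hge
    · rw [e, coeff_add, coeff_C_mul, hε₁ k (Finset.mem_range.2 hlt), hsgn k hlt]
    · have hk : k = (C c * rootProd (l ++ [-ε⁻¹])).natDegree := by rw [hdeg]; omega
      rw [if_neg (by omega : ¬ k < q), if_neg (by omega : ¬ k < q + n), hk, coeff_natDegree, hlead, sign_pos hc]
  · rw [List.pairwise_append]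
    refine ⟨hp, List.pairwise_singleton _ _, ?_⟩
    intro x hx y hy
    rw [List.mem_singleton.1 hy, abs_neg, abs_inv, abs_of_pos hε, ← one_div, lt_div_iff₀ hε, mul_comm]
    exact hε₂ x (List.mem_toFinset.2 hx)
  · have : ¬ (0 < -ε⁻¹) := by simp [hε.le]
    rw [List.map_append, ho, List.map_singleton, letterOf, if_neg this]
    simp [tripleOrder, List.replicate_succ']

lemma Realizable.add {m n q u v w : ℕ} (hm : 0 < m) (hq : 0 < q)
    (h : Realizable (Sigma3 m n q) (tripleOrder u v w)) (k : ℕ) :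
    Realizable (Sigma3 (m + k) n q) (tripleOrder u v (w + k)) := by
  induction k with
  | zero => exact h
  | succ k ih => exact ih.succ (Nat.add_pos_left hm k) hq

/-- The coefficients of `rootProd l`, computed recursively. -/
def rootProdCoeff : List ℝ → ℕ → ℝ
  | [], 0 => 1
  | [], _ + 1 => 0
  | r :: l, 0 => -(r * rootProdCoeff l 0)
  | r :: l, k + 1 => rootProdCoeff l k - r * rootProdCoeff l (k + 1)

lemma rootProd_coeff (l : List ℝ) (k : ℕ) : (rootProd l).coeff k = rootProdCoeff l k := by
  induction l generalizing k with
  | nil => cases k <;> simp [rootProdCoeff, coeff_one]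
  | cons r l ih =>
    cases k with
    | zero => rw [rootProd_cons, coeff_zero_X_sub_C_mul, ih, rootProdCoeff]
    | succ k => rw [rootProd_cons, coeff_succ_X_sub_C_mul, ih, ih, rootProdCoeff]

/-- A criterion for the realizability by a monic polynomial of degree six with prescribed roots. -/
lemma realizable_of_six_roots (x₁ x₂ x₃ x₄ x₅ x₆ : ℝ) (u v w : ℕ)
    (hp : [x₁, x₂, x₃, x₄, x₅, x₆].Pairwise (fun x y => |x| < |y|))
    (ho : [x₁, x₂, x₃, x₄, x₅, x₆].map letterOf = tripleOrder u v w)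
    (h₀ : 0 < rootProdCoeff [x₁, x₂, x₃, x₄, x₅, x₆] 0)
    (h₁ : 0 < rootProdCoeff [x₁, x₂, x₃, x₄, x₅, x₆] 1)
    (h₂ : rootProdCoeff [x₁, x₂, x₃, x₄, x₅, x₆] 2 < 0)
    (h₃ : rootProdCoeff [x₁, x₂, x₃, x₄, x₅, x₆] 3 < 0)
    (h₄ : 0 < rootProdCoeff [x₁, x₂, x₃, x₄, x₅, x₆] 4)
    (h₅ : 0 < rootProdCoeff [x₁, x₂, x₃, x₄, x₅, x₆] 5) :
    Realizable (Sigma3 3 2 2) (tripleOrder u v w) := by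
  simp only [← rootProd_coeff] at h₀ h₁ h₂ h₃ h₄ h₅
  set l := [x₁, x₂, x₃, x₄, x₅, x₆] with hl
  have hd : (rootProd l).natDegree = 6 := by rw [rootProd_natDegree]; rfl
  have h₆ : (rootProd l).coeff 6 = 1 := by
    rw [← hd, coeff_natDegree, (rootProd_monic l).leadingCoeff]
  refine ⟨rootProd l, (realizes_iff (rootProd_monic l).ne_zero).2
    ⟨l, by rw [(rootProd_monic l).leadingCoeff]; simp, signPattern_eq_iff.2 ⟨by rw [hd], ?_⟩,
      hp, ho⟩⟩
  intro k hk
  interval_cases k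
  · simpa using sign_pos h₀
  · simpa using sign_pos h₁
  · simpa using sign_neg h₂
  · simpa using sign_neg h₃
  · simpa using sign_pos h₄
  · simpa using sign_pos h₅
  · simp [h₆]

/-- Base case `m = 3`: there are four negative roots, so `w = 4 - (u + v)`, and integer roots serve
as witnesses. -/
lemma realizable_sextic {u v : ℕ} (h : u + v ≤ 3) :
    Realizable (Sigma3 3 2 2) (tripleOrder u v (4 - (u + v))) := by
  have hu : u ≤ 3 := by omega
  have hv : v ≤ 3 := by omega
  interval_cases u <;> interval_cases v <;> try omega
  · apply realizable_of_six_roots 3 4 (-5) (-6) (-7) (-11)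
    all_goals norm_num [tripleOrder, letterOf, List.replicate, rootProdCoeff]
  · apply realizable_of_six_roots 3 (-4) 5 (-6) (-7) (-11)
    all_goals norm_num [tripleOrder, letterOf, List.replicate, rootProdCoeff]
  · apply realizable_of_six_roots 2 (-3) (-9) 10 (-11) (-12)
    all_goals norm_num [tripleOrder, letterOf, List.replicate, rootProdCoeff]
  · apply realizable_of_six_roots 3 (-7) (-8) (-9) 11 (-12)
    all_goals norm_num [tripleOrder, letterOf, List.replicate, rootProdCoeff]
  · apply realizable_of_six_roots (-2) 3 9 (-10) (-11) (-12)
    all_goals norm_num [tripleOrder, letterOf, List.replicate, rootProdCoeff]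
  · apply realizable_of_six_roots (-1) 2 (-4) 5 (-6) (-11)
    all_goals norm_num [tripleOrder, letterOf, List.replicate, rootProdCoeff]
  · apply realizable_of_six_roots (-2) 3 (-5) (-6) 7 (-20)
    all_goals norm_num [tripleOrder, letterOf, List.replicate, rootProdCoeff]
  · apply realizable_of_six_roots (-2) (-3) 4 5 (-9) (-12)
    all_goals norm_num [tripleOrder, letterOf, List.replicate, rootProdCoeff]
  · apply realizable_of_six_roots (-9) (-10) 12 (-16) 18 (-92)
    all_goals norm_num [tripleOrder, letterOf, List.replicate, rootProdCoeff]
  · apply realizable_of_six_roots (-7) (-9) (-10) 11 12 (-100)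
    all_goals norm_num [tripleOrder, letterOf, List.replicate, rootProdCoeff]

lemma realizable_sextic_zero_four : Realizable (Sigma3 3 2 2) (tripleOrder 0 4 0) := by
  apply realizable_of_six_roots 3 (-8) (-9) (-10) (-11) 12
  all_goals norm_num [tripleOrder, letterOf, List.replicate, rootProdCoeff]

theorem realizable_of_add_le_three {m u v w : ℕ} (hm : 3 ≤ m) (hs : u + v + w = m + 1)
    (h : u + v ≤ 3) : Realizable (Sigma3 m 2 2) (tripleOrder u v w) := by
  have := (realizable_sextic h).add three_pos two_pos (m - 3)
  rwa [show 3 + (m - 3) = m by omega, show 4 - (u + v) + (m - 3) = w by omega] at this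

theorem realizable_zero_four {m : ℕ} (hm : 3 ≤ m) :
    Realizable (Sigma3 m 2 2) (tripleOrder 0 4 (m - 3)) := by
  have := realizable_sextic_zero_four.add three_pos two_pos (m - 3)
  rwa [show 3 + (m - 3) = m by omega, show 0 + (m - 3) = m - 3 by omega] at this

/-! ### Counting triples -/

lemma ncard_triples_add_le {d k : ℕ} (h : k + 2 ≤ d) :
    {t ∈ triples d | t.1 + t.2.1 ≤ k}.ncard =
      ((Finset.range (k + 1) ×ˢ Finset.range (k + 1)).filter fun p => p.1 + p.2 ≤ k).card := by
  -- The pair `(u, v)` determines `w`; `k + 2 ≤ d` prevents the subtraction from truncating. The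
  -- count is then independent of `d`.
  have e : {t ∈ triples d | t.1 + t.2.1 ≤ k} =
      (((Finset.range (k + 1) ×ˢ Finset.range (k + 1)).filter fun p => p.1 + p.2 ≤ k).image
        fun p => (p.1, p.2, d - 2 - (p.1 + p.2)) : Finset (ℕ × ℕ × ℕ)) := by
    ext ⟨u, v, w⟩
    simp only [triples, Set.mem_ofPred_eq, Finset.coe_image, Set.mem_image, Finset.mem_coe,
      Finset.mem_filter, Finset.mem_product, Finset.mem_range, Prod.mk.injEq, Prod.exists]
    constructor
    · rintro ⟨h1, h2⟩
      exact ⟨u, v, ⟨⟨by omega, by omega⟩, h2⟩, rfl, rfl, by omega⟩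
    · rintro ⟨u, v, ⟨-, h2⟩, rfl, rfl, rfl⟩
      omega
  rw [e, Set.ncard_coe_finset, Finset.card_image_of_injective]
  rintro ⟨a, b⟩ ⟨a', b'⟩ hab
  simp only [Prod.mk.injEq] at hab ⊢
  exact ⟨hab.1, hab.2.1⟩

lemma ncard_triples_add_le_reverse (d k : ℕ) :
    {t ∈ triples d | t.2.1 + t.2.2 ≤ k}.ncard = {t ∈ triples d | t.1 + t.2.1 ≤ k}.ncard := by
  have hinj : Function.Injective fun t : ℕ × ℕ × ℕ => (t.2.2, t.2.1, t.1) := by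
    rintro ⟨a, b, c⟩ ⟨a', b', c'⟩ h
    simp only [Prod.mk.injEq] at h ⊢
    exact ⟨h.2.2, h.2.1, h.1⟩
  rw [← Set.ncard_image_of_injective _ hinj]
  congr 1
  ext ⟨u, v, w⟩
  simp only [triples, Set.mem_ofPred_eq, Set.mem_image, Prod.mk.injEq, Prod.exists]
  constructor
  · rintro ⟨a, b, c, ⟨h1, h2⟩, rfl, rfl, rfl⟩
    omega
  · rintro ⟨h1, h2⟩
    exact ⟨w, v, u, ⟨by omega, by omega⟩, rfl, rfl, rfl⟩

lemma add_add_eq_of_realizable {m n q u v w : ℕ} (h : Realizable (Sigma3 m n q) (tripleOrder u v w))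
    (hq : 0 < q) : u + v + w + 3 = m + n + q := by
  obtain ⟨Q, hQ⟩ := h
  have h0 : 0 < Q.coeff 0 := coeff_pos_of_signPattern hQ.2.1 (Or.inl hq)
  have hQ0 : Q ≠ 0 := by rintro rfl; simp at h0
  obtain ⟨l, hl, hs, -, ho⟩ := (realizes_iff hQ0).1 hQ
  have h1 := congrArg natDegree hl
  rw [natDegree_C_mul (leadingCoeff_ne_zero.2 hQ0), rootProd_natDegree] at h1
  have h2 := congrArg List.length ho
  simp [tripleOrder] at h2
  have := (signPattern_eq_iff.1 hs).1
  omega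

end DescartesModuli

/-! ### Assembly of the three statements and their reversals -/

theorem theorem1 (d m : ℕ) (hd : d = m + 3) :
    -- part (1)
    (7 ≤ d →
      (∀ u v w : ℕ, DescartesModuli.Realizable (DescartesModuli.Sigma3 m 2 2)
          (DescartesModuli.tripleOrder u v w) → (m : ℤ) - 3 ≤ (w : ℤ)) ∧
      {t ∈ DescartesModuli.triples d | (m : ℤ) - 3 ≤ (t.2.2 : ℤ)}.ncard = 15) ∧
    -- part (2)
    (6 ≤ d →
      (∀ t ∈ DescartesModuli.triples d, t.1 + t.2.1 ≤ 3 →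
        DescartesModuli.Realizable (DescartesModuli.Sigma3 m 2 2)
          (DescartesModuli.tripleOrder t.1 t.2.1 t.2.2)) ∧
      {t ∈ DescartesModuli.triples d | t.1 + t.2.1 ≤ 3}.ncard = 10 ∧
      DescartesModuli.Realizable (DescartesModuli.Sigma3 m 2 2)
        (DescartesModuli.tripleOrder 0 4 (m - 3))) ∧
    -- part (3)
    (6 ≤ d →
      ¬ DescartesModuli.Realizable (DescartesModuli.Sigma3 m 2 2)
        (DescartesModuli.tripleOrder 4 0 (m - 3)) ∧
      ¬ DescartesModuli.Realizable (DescartesModuli.Sigma3 m 2 2)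
        (DescartesModuli.tripleOrder 3 1 (m - 3)) ∧
      ¬ DescartesModuli.Realizable (DescartesModuli.Sigma3 m 2 2)
        (DescartesModuli.tripleOrder 2 2 (m - 3)) ∧
      ¬ DescartesModuli.Realizable (DescartesModuli.Sigma3 m 2 2)
        (DescartesModuli.tripleOrder 1 3 (m - 3))) ∧
    -- the involution exchanges the two families of couples
    (6 ≤ d → ∀ (Q : Polynomial ℝ) (u v w : ℕ),
      (DescartesModuli.Realizes Q (DescartesModuli.Sigma3 m 2 2)
          (DescartesModuli.tripleOrder u v w) →
        DescartesModuli.Realizes (DescartesModuli.invR Q) (DescartesModuli.Sigma3 2 2 m)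
          (DescartesModuli.tripleOrder w v u)) ∧
      (DescartesModuli.Realizes Q (DescartesModuli.Sigma3 2 2 m)
          (DescartesModuli.tripleOrder w v u) →
        DescartesModuli.Realizes (DescartesModuli.invR Q) (DescartesModuli.Sigma3 m 2 2)
          (DescartesModuli.tripleOrder u v w))) ∧
    -- part (1) for the reversed sign pattern
    (7 ≤ d →
      (∀ u v w : ℕ, DescartesModuli.Realizable (DescartesModuli.Sigma3 2 2 m)
          (DescartesModuli.tripleOrder u v w) → (m : ℤ) - 3 ≤ (u : ℤ)) ∧
      {t ∈ DescartesModuli.triples d | (m : ℤ) - 3 ≤ (t.1 : ℤ)}.ncard = 15) ∧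
    -- part (2) for the reversed sign pattern
    (6 ≤ d →
      (∀ t ∈ DescartesModuli.triples d, t.2.1 + t.2.2 ≤ 3 →
        DescartesModuli.Realizable (DescartesModuli.Sigma3 2 2 m)
          (DescartesModuli.tripleOrder t.1 t.2.1 t.2.2)) ∧
      {t ∈ DescartesModuli.triples d | t.2.1 + t.2.2 ≤ 3}.ncard = 10 ∧
      DescartesModuli.Realizable (DescartesModuli.Sigma3 2 2 m)
        (DescartesModuli.tripleOrder (m - 3) 4 0)) ∧
    -- part (3) for the reversed sign pattern
    (6 ≤ d →
      ¬ DescartesModuli.Realizable (DescartesModuli.Sigma3 2 2 m)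
        (DescartesModuli.tripleOrder (m - 3) 0 4) ∧
      ¬ DescartesModuli.Realizable (DescartesModuli.Sigma3 2 2 m)
        (DescartesModuli.tripleOrder (m - 3) 1 3) ∧
      ¬ DescartesModuli.Realizable (DescartesModuli.Sigma3 2 2 m)
        (DescartesModuli.tripleOrder (m - 3) 2 2) ∧
      ¬ DescartesModuli.Realizable (DescartesModuli.Sigma3 2 2 m)
        (DescartesModuli.tripleOrder (m - 3) 3 1)) := by
  open DescartesModuli in
  subst hd
  have swap : ∀ {u v w : ℕ}, 3 ≤ m → (Realizable (Sigma3 2 2 m) (tripleOrder w v u) ↔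
      Realizable (Sigma3 m 2 2) (tripleOrder u v w)) := fun hm =>
    realizable_reverse_iff (by omega) two_pos
  have bound : ∀ u v w : ℕ, 7 ≤ m + 3 → Realizable (Sigma3 m 2 2) (tripleOrder u v w) →
      (m : ℤ) - 3 ≤ (w : ℤ) := by
    intro u v w hm h
    have h1 := add_le_four_of_realizable (by omega) h
    have h2 := add_add_eq_of_realizable h two_pos
    omega
  -- Since `u + v + w = m + 1`, the condition `w ≥ m - 3` is `u + v ≤ 4`.
  have card₁₅ : 7 ≤ m + 3 → {t ∈ triples (m + 3) | t.1 + t.2.1 ≤ 4}.ncard = 15 := fun hm => by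
    rw [ncard_triples_add_le (by omega)]; decide
  have card₁₀ : 6 ≤ m + 3 → {t ∈ triples (m + 3) | t.1 + t.2.1 ≤ 3}.ncard = 10 := fun hm => by
    rw [ncard_triples_add_le (by omega)]; decide
  refine ⟨fun hm => ⟨fun u v w => bound u v w hm, ?_⟩, fun hm => ⟨?_, card₁₀ hm, ?_⟩,
    fun hm => ⟨?_, ?_, ?_, ?_⟩,
    fun hm Q u v w => ⟨fun h => h.invR two_pos, fun h => h.invR (by omega)⟩,
    fun hm => ⟨fun u v w h => bound w v u hm ((swap (by omega)).1 h), ?_⟩,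
    fun hm => ⟨?_, ?_, ?_⟩, fun hm => ⟨?_, ?_, ?_, ?_⟩⟩
  · rw [← card₁₅ hm]
    congr 1
    ext ⟨u, v, w⟩
    simp only [triples, Set.mem_ofPred_eq]
    omega
  · intro t ht h
    exact realizable_of_add_le_three (by omega) (by simp only [triples, Set.mem_ofPred_eq] at ht; omega) h
  · exact realizable_zero_four (by omega)
  iterate 4 exact not_realizable_of_add_eq_four (by omega) (by omega) rfl
  · rw [← card₁₅ hm, ← ncard_triples_add_le_reverse]
    congr 1
    ext ⟨u, v, w⟩
    simp only [triples, Set.mem_ofPred_eq]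
    omega
  · intro t ht h
    exact (swap (by omega)).2 (realizable_of_add_le_three (by omega)
      (by simp only [triples, Set.mem_ofPred_eq] at ht; omega) (by omega))
  · rw [ncard_triples_add_le_reverse, card₁₀ hm]
  · exact (swap (by omega)).2 (realizable_zero_four (by omega))
  all_goals
    rw [swap (by omega)]
    exact not_realizable_of_add_eq_four (by omega) (by omega) rfl
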